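/- Let the triangular grid be the graph with vertex set $\mathbb{Z}^2$ in which $u$ and $v$ are adjacent if and only if $u-v\in\{(\pm1,0),(0,\pm1),(1,1),(-1,-1)\}$, and let $D=\{(0,0),(\pm1,0),(0,\pm1),(1,1),(-1,-1)\}$ be the closed $1$-neighborhood of the origin in it. Let $b,a$ be non-negative integers with $b-a\neq-1$. A configuration $c\in\{0,1\}^{\mathbb{Z}^2}$ is a $(D,b,a)$-covering if for every $u\in\mathbb{Z}^2$ the number of $v\in u+D$ with $c_v=1$ equals $b$ when $c_u=1$ and equals $a$ when $c_u=0$. A set $S\subseteq\mathbb{Z}^2$ is a $(1,b,a)$-covering of the triangular grid if for every $u\in\mathbb{Z}^2$ the closed $1$-neighborhood of $u$ (the set of vertices at graph distance at most $1$ from $u$) contains exactly $b$ elements of $S$ when $u\in S$ and exactly $a$ elements of $S$ when $u\notin S$. A configuration or a set is two-periodic if it is invariant under the translations by two linearly independent vectors $t_1,t_2\in\mathbb{Z}^2$. Then every $(D,b,a)$-covering is two-periodic. In other words, every $(1,b,a)$-covering of the triangular grid is two-periodic. -/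

import Mathlib

namespace PerfectCovering

/-- The triangular grid: vertices are the points of `ℤ²`, and `u`, `v` are adjacent exactly when
`u - v` is one of `(±1,0)`, `(0,±1)`, `(1,1)`, `(-1,-1)`. -/
def triangularGrid : SimpleGraph (ℤ × ℤ) where
  Adj u v := u - v ∈
    ({(1, 0), (-1, 0), (0, 1), (0, -1), (1, 1), (-1, -1)} : Set (ℤ × ℤ))
  symm := ⟨by
    rintro ⟨a, b⟩ ⟨c, d⟩ h
    simp only [Prod.mk_sub_mk, Set.mem_insert_iff, Set.mem_singleton_iff, Prod.mk.injEq] at h ⊢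
    omega⟩
  loopless := ⟨by
    rintro ⟨a, b⟩ h
    simp [Prod.ext_iff] at h⟩

/-- The closed `r`-neighborhood `N_r(u)`: the vertices at graph distance at most `r` from `u`.
The extended distance is used, so that unreachable vertices are at distance `⊤`. -/
def closedNeighborhood {V : Type*} (G : SimpleGraph V) (r : ℕ) (u : V) : Set V :=
  {v | G.edist v u ≤ (r : ℕ∞)}

/-- A code `S ⊆ V` is an `(r,b,a)`-covering in `G` if the closed `r`-neighborhood of every vertex
of `S` contains exactly `b` elements of `S`, and that of every vertex outside `S` contains
exactly `a` elements of `S`. -/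
def IsCodeCovering {V : Type*} (G : SimpleGraph V) (r b a : ℕ) (S : Set V) : Prop :=
  ∀ u : V,
    (u ∈ S → (closedNeighborhood G r u ∩ S).encard = (b : ℕ∞)) ∧
    (u ∉ S → (closedNeighborhood G r u ∩ S).encard = (a : ℕ∞))

/-- A binary configuration `c : ℤ² → {0,1}` is a `(D,b,a)`-covering if for every `u` the pattern of
`c` on `u + D` contains exactly `b` symbols `1` when `c u = 1` and exactly `a` symbols `1` when
`c u = 0`. -/
def IsConfigCovering (D : Set (ℤ × ℤ)) (b a : ℕ) (c : ℤ × ℤ → Fin 2) : Prop :=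
  ∀ u : ℤ × ℤ,
    (c u = 1 → {v ∈ (fun d => u + d) '' D | c v = 1}.encard = (b : ℕ∞)) ∧
    (c u = 0 → {v ∈ (fun d => u + d) '' D | c v = 1}.encard = (a : ℕ∞))

/-- A code `S ⊆ ℤ²` is two-periodic if `S = S + t₁` and `S = S + t₂` for two linearly independent
vectors `t₁`, `t₂ ∈ ℤ²`. -/
def IsTwoPeriodicCode (S : Set (ℤ × ℤ)) : Prop :=
  ∃ t₁ t₂ : ℤ × ℤ, LinearIndependent ℤ ![t₁, t₂] ∧
    S = (fun s => s + t₁) '' S ∧ S = (fun s => s + t₂) '' S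

/-- The translation of a configuration by `t`. -/
def translate {A : Type*} (t : ℤ × ℤ) (c : ℤ × ℤ → A) : ℤ × ℤ → A :=
  fun u => c (u - t)

/-- A configuration on `ℤ²` is two-periodic if it is invariant under the translations by two
linearly independent vectors. -/
def IsTwoPeriodicConfig {A : Type*} (c : ℤ × ℤ → A) : Prop :=
  ∃ t₁ t₂ : ℤ × ℤ, LinearIndependent ℤ ![t₁, t₂] ∧
    translate t₁ c = c ∧ translate t₂ c = c

end PerfectCovering

/-!
Write a covering as a function `c : ℤ² → {0, 1}` and put `k = 1 - (b - a)`. The covering condition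
says that the sum of `c` over the six neighbors of `u`, plus `k * c u`, is the constant `a`; in
terms of Laurent polynomials acting by translations, `f c = a` with
`f = x + x⁻¹ + y + y⁻¹ + xy + x⁻¹y⁻¹ + k`. For `k = 2` this factors as
`(1 + x) (1 + y) (1 + x⁻¹y⁻¹)`, which is why `b - a = -1` is excluded. Exchanging the coordinates
preserves `f`, so it suffices to find a period in the direction `(0, 1)`.

The difference `g = (y - 1) c` has values in `{-1, 0, 1}` and `f g = 0`. Modulo a prime `p` the
dilation `f(x ^ p, y ^ p)` is `f ^ p`, so it maps `g` to multiples of `p`, which are zero once `p` is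
large; hence all dilations `f(x ^ n, y ^ n)` with `n = 1 + m R`, `R` a fixed factorial, annihilate
`g` (`stencil_dilation`). Their terms are `w_i A_i ^ m`, with `A_i` the `R`-th power of the `i`-th
monomial of `f`, so Lagrange interpolation isolates one term: `∏_{j ≠ i} (A_i - A_j)` annihilates
`g` (`mul_prod_sub_mem_of_powerSum_mem`).

Choose the monomial `y` for `i`. Over `ℂ` each difference `y ^ R - z ^ R` splits into binomials
`y - ω z`, and each of these allows one to express `x` as a constant times a power of `y` (or
involves `y` alone). Substituting into `f` gives a Laurent polynomial in `y` which is nonzero as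
`k ≠ 2`. Thus the ideal generated by `f` and the binomial contains a nonzero polynomial in `y`
(`EliminatesTo`), and multiplying over all binomials so does the annihilator of `g`
(`exists_recurrence_of_hexagon`). So the columns of `c` satisfy one common linear recurrence, and
having finitely many symbols they have a common period (`exists_uniform_period_of_recurrence`).
-/

namespace PerfectCovering

open Finset Polynomial

/-! ### Group algebras acting on functions by translation -/

section Action

variable {G : Type*} [AddCommMonoid G]

/-- The translation operators `g ↦ g (· + d)` on functions `G → R`. -/
def shiftHom (R G : Type*) [CommRing R] [AddCommMonoid G] :
    Multiplicative G →* Module.End R (G → R) where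
  toFun d := LinearMap.funLeft R R (fun u => u + d.toAdd)
  map_one' := by ext g u; simp [LinearMap.funLeft_apply]
  map_mul' d e := by
    ext g u
    simp [LinearMap.funLeft_apply, add_comm, add_left_comm]

/-- The action of the group algebra on functions `G → R`, in which the monomial `d` acts as the
translation `g ↦ g (· + d)`. -/
noncomputable def shiftAction (R G : Type*) [CommRing R] [AddCommMonoid G] :
    AddMonoidAlgebra R G →ₐ[R] Module.End R (G → R) :=
  AddMonoidAlgebra.lift R _ G (shiftHom R G)

theorem shiftAction_single {R : Type*} [CommRing R] (d : G) (r : R) (g : G → R) (u : G) :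
    shiftAction R G (AddMonoidAlgebra.single d r) g u = r * g (u + d) := by
  simp [shiftAction, AddMonoidAlgebra.lift_single, shiftHom, LinearMap.funLeft_apply]

theorem shiftAction_sum_single {R : Type*} [CommRing R] {ι : Type*} (D : Finset ι) (e : ι → G)
    (w : ι → R) (g : G → R) (u : G) :
    shiftAction R G (∑ i ∈ D, AddMonoidAlgebra.single (e i) (w i)) g u =
      ∑ i ∈ D, w i * g (u + e i) := by
  simp [map_sum, LinearMap.sum_apply, Finset.sum_apply, shiftAction_single]

/-- The ideal of all elements of the group algebra that annihilate a given function. -/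
noncomputable def annihilatorIdeal {R : Type*} [CommRing R] (g : G → R) :
    Ideal (AddMonoidAlgebra R G) where
  carrier := {p | shiftAction R G p g = 0}
  add_mem' {p q} hp hq := by
    simp only [Set.mem_ofPred_eq] at *
    simp [hp, hq]
  zero_mem' := by simp
  smul_mem' p q hq := by
    simp only [Set.mem_ofPred_eq] at *
    simp [hq]

theorem mem_annihilatorIdeal {R : Type*} [CommRing R] {g : G → R} {p : AddMonoidAlgebra R G} :
    p ∈ annihilatorIdeal g ↔ shiftAction R G p g = 0 := Iff.rfl

/-! ### Dilating an annihilator of a bounded integer function -/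

/-- If `g` takes values in `{-1, 0, 1}` and is annihilated by a finite stencil, then it is also
annihilated by the stencil dilated by any prime exceeding the total weight of the stencil:
modulo `p` the dilated stencil is the `p`-th power of the stencil, and the resulting multiple
of `p` is too small to be nonzero. -/
theorem stencil_prime_dilation {D : Finset G} {w : G → ℤ} {g : G → ℤ} (hg : ∀ u, |g u| ≤ 1)
    {p n : ℕ} (hp : p.Prime) (hpw : ∑ d ∈ D, |w d| < p)
    (h : ∀ u, ∑ d ∈ D, w d * g (u + n • d) = 0) (u : G) :
    ∑ d ∈ D, w d * g (u + (p * n) • d) = 0 := by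
  have : Fact p.Prime := ⟨hp⟩
  have : CharP (AddMonoidAlgebra (ZMod p) G) p :=
    charP_of_injective_algebraMap (algebraMap (ZMod p) _).injective p
  set q : AddMonoidAlgebra (ZMod p) G :=
    ∑ d ∈ D, AddMonoidAlgebra.single (n • d) (w d : ZMod p) with hq
  set g' : G → ZMod p := fun u => (g u : ZMod p) with hg'
  have hmem : q ∈ annihilatorIdeal g' := by
    rw [mem_annihilatorIdeal]
    ext v
    rw [hq, shiftAction_sum_single]
    simpa [hg'] using congrArg (Int.cast : ℤ → ZMod p) (h v)
  have hpow : q ^ p = ∑ d ∈ D, AddMonoidAlgebra.single ((p * n) • d) (w d : ZMod p) := by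
    rw [hq, sum_pow_char]
    refine Finset.sum_congr rfl fun d _ => ?_
    rw [AddMonoidAlgebra.single_pow, ZMod.pow_card, smul_smul]
  have hmem' := (annihilatorIdeal g').pow_mem_of_mem hmem p hp.pos
  rw [hpow, mem_annihilatorIdeal] at hmem'
  have hdvd : (p : ℤ) ∣ ∑ d ∈ D, w d * g (u + (p * n) • d) := by
    rw [← ZMod.intCast_zmod_eq_zero_iff_dvd]
    have := congrFun hmem' u
    rw [shiftAction_sum_single] at this
    simpa [hg'] using this
  refine Int.eq_zero_of_abs_lt_dvd hdvd (lt_of_le_of_lt ?_ hpw)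
  refine (Finset.abs_sum_le_sum_abs _ _).trans (Finset.sum_le_sum fun d _ => ?_)
  rw [abs_mul]
  exact mul_le_of_le_one_right (abs_nonneg _) (hg _)

/-- Dilation by every number without small prime factors. -/
theorem stencil_dilation {D : Finset G} {w : G → ℤ} {g : G → ℤ} (hg : ∀ u, |g u| ≤ 1)
    (h : ∀ u, ∑ d ∈ D, w d * g (u + d) = 0) (n : ℕ) (hn0 : n ≠ 0)
    (hn : ∀ p : ℕ, p.Prime → p ∣ n → ∑ d ∈ D, |w d| < p) (u : G) :
    ∑ d ∈ D, w d * g (u + n • d) = 0 := by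
  induction n using induction_on_primes generalizing u with
  | zero => exact absurd rfl hn0
  | one => simpa using h u
  | prime_mul p a hp ih =>
    have ha : a ≠ 0 := right_ne_zero_of_mul hn0
    exact stencil_prime_dilation hg hp (hn p hp (dvd_mul_right p a))
      (ih ha fun q hq hqa => hn q hq (hqa.mul_left p)) u

end Action

/-! ### Isolating one monomial of the dilated annihilators -/

/-- Lagrange interpolation inside an ideal: if all the power sums `∑ w_i A_i ^ m` lie in `I`, then
so does `∑ w_i Q(A_i)` for every polynomial `Q`, in particular for `Q = ∏_{j ≠ i} (T - A_j)`. -/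
theorem mul_prod_sub_mem_of_powerSum_mem {A ι : Type*} [CommRing A] [DecidableEq ι]
    {I : Ideal A} {D : Finset ι} {w z : ι → A} (h : ∀ m : ℕ, ∑ i ∈ D, w i * z i ^ m ∈ I)
    {i : ι} (hi : i ∈ D) : w i * ∏ j ∈ D.erase i, (z i - z j) ∈ I := by
  have key : ∀ Q : A[X], ∑ j ∈ D, w j * Q.eval (z j) ∈ I := by
    intro Q
    have : ∑ j ∈ D, w j * Q.eval (z j) =
        ∑ m ∈ range (Q.natDegree + 1), Q.coeff m * ∑ j ∈ D, w j * z j ^ m := by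
      simp_rw [Polynomial.eval_eq_sum_range, Finset.mul_sum]
      rw [Finset.sum_comm]
      exact Finset.sum_congr rfl fun _ _ => Finset.sum_congr rfl fun _ _ => by ring
    rw [this]
    exact I.sum_mem fun m _ => I.mul_mem_left _ (h m)
  -- this `Q` vanishes at all `z j` except `z i`
  have := key (∏ j ∈ D.erase i, (X - C (z j)))
  rw [Finset.sum_eq_single_of_mem i hi] at this
  · simpa [Polynomial.eval_prod] using this
  · intro j hj hji
    rw [Polynomial.eval_prod, Finset.prod_eq_zero (i := j) (by simp [hj, hji]) (by simp), mul_zero]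

/-! ### Eliminating a variable -/

section Elimination

variable {A : Type*} [CommRing A] [Algebra ℂ A]

/-- The ideal `(f, h)` contains the value at `y` of a nonzero polynomial: modulo `f` and `h`, the
element `y` is algebraic over `ℂ`. -/
def EliminatesTo (y f h : A) : Prop :=
  ∃ P : ℂ[X], P ≠ 0 ∧ ∃ a b : A, aeval y P = a * f + b * h

theorem EliminatesTo.one (y f : A) : EliminatesTo y f 1 :=
  ⟨1, one_ne_zero, 0, 1, by simp⟩

theorem EliminatesTo.mul {y f h₁ h₂ : A} (H₁ : EliminatesTo y f h₁) (H₂ : EliminatesTo y f h₂) :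
    EliminatesTo y f (h₁ * h₂) := by
  obtain ⟨P, hP, a, b, h⟩ := H₁
  obtain ⟨Q, hQ, c, d, h'⟩ := H₂
  refine ⟨P * Q, mul_ne_zero hP hQ, a * c * f + a * d * h₂ + b * c * h₁, b * d, ?_⟩
  rw [map_mul, h, h']
  ring

theorem EliminatesTo.prod {ι : Type*} {y f : A} {s : Finset ι} {h : ι → A}
    (H : ∀ i ∈ s, EliminatesTo y f (h i)) : EliminatesTo y f (∏ i ∈ s, h i) :=
  Finset.prod_induction h (EliminatesTo y f) (fun _ _ => EliminatesTo.mul)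
    (EliminatesTo.one y f) H

theorem EliminatesTo.of_dvd {y f h h' : A} (H : EliminatesTo y f h) (hd : h' ∣ h) :
    EliminatesTo y f h' := by
  obtain ⟨P, hP, a, b, e⟩ := H
  obtain ⟨u, rfl⟩ := hd
  exact ⟨P, hP, a, b * u, by rw [e]; ring⟩

/-- A binomial `y ^ n - z ^ n` is a product of the factors `y - ω z` with `ω ^ n = 1`. -/
theorem EliminatesTo.pow_sub_pow {y f z z' : A} (hz : z * z' = 1) {n : ℕ} (hn : 0 < n)
    (H : ∀ ω : ℂ, ω ≠ 0 → EliminatesTo y f (y - algebraMap ℂ A ω * z)) :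
    EliminatesTo y f (y ^ n - z ^ n) := by
  have hfac := congrArg (aeval (y * z')) (X_pow_sub_one_eq_prod hn
    (Complex.isPrimitiveRoot_exp n hn.ne'))
  simp only [map_sub, map_pow, aeval_X, map_one, map_prod, aeval_C] at hfac
  have hzn : z ^ n * z' ^ n = 1 := by rw [← mul_pow, hz, one_pow]
  refine (EliminatesTo.prod (s := nthRootsFinset n (1 : ℂ))
    (h := fun ω => y * z' - algebraMap ℂ A ω) fun ω hω => ?_).of_dvd ?_
  · have hω0 : ω ≠ 0 := ne_zero_of_mem_nthRootsFinset one_ne_zero hω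
    refine (H ω hω0).of_dvd ⟨z, ?_⟩
    linear_combination -y * hz
  -- `(y ^ n - z ^ n) * z' ^ n = (y * z') ^ n - 1`, so a root of unity factorization applies
  · rw [← hfac]
    refine ⟨z' ^ n, ?_⟩
    rw [mul_pow]
    linear_combination hzn

variable {x x' y y' : A}

/-- The Laurent polynomial of the hexagonal neighborhood, with the weight `k` at the center; `x'` and
`y'` stand for the inverses of `x` and `y`. -/
def hexPoly (k : ℤ) (x x' y y' : A) : A := x + x' + y + y' + x * y + x' * y' + k

variable {k : ℤ}

theorem algebraMap_mul_inv {ω : ℂ} (hω : ω ≠ 0) :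
    algebraMap ℂ A ω * algebraMap ℂ A ω⁻¹ = 1 := by
  rw [← map_mul, mul_inv_cancel₀ hω, map_one]

theorem eliminatesTo_sub_const (ω : ℂ) (f : A) : EliminatesTo y f (y - algebraMap ℂ A ω * 1) :=
  ⟨X - C ω, X_sub_C_ne_zero ω, 0, 1, by simp⟩

theorem eliminatesTo_sub_y' (hy : y * y' = 1) (ω : ℂ) (f : A) :
    EliminatesTo y f (y - algebraMap ℂ A ω * y') := by
  refine ⟨X ^ 2 - C ω, X_pow_sub_C_ne_zero two_pos ω, 0, y, ?_⟩
  simp only [map_sub, map_pow, aeval_X, aeval_C]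
  linear_combination algebraMap ℂ A ω * hy

/-- The shape of the substituted polynomial in the directions not parallel to a side of the hexagon:
its leading monomial comes from a single vertex, so it does not vanish. -/
theorem quartic_ne_zero {α β κ : ℂ} (hα : α ≠ 0) :
    (C α * (X ^ 4 + X ^ 3) + C β * (X + 1) + X ^ 3 + X + C κ * X ^ 2 : ℂ[X]) ≠ 0 := by
  intro h
  apply hα
  simpa [coeff_X, coeff_one, coeff_X_pow, coeff_C_mul] using congrArg (fun P => coeff P 4) h

/-- In the two directions parallel to sides of the hexagon, the substituted polynomial is nonzero
because `k ≠ 2`. -/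
theorem quadratic_ne_zero {ω : ℂ} (hk : k ≠ 2) :
    (C ω * (X + 1) + C ω⁻¹ * (X ^ 2 + X) + X ^ 2 + 1 + C (k : ℂ) * X : ℂ[X]) ≠ 0 := by
  intro h
  have h0 := congrArg (fun P => coeff P 0) h
  have h1 := congrArg (fun P => coeff P 1) h
  simp [coeff_X, coeff_one, coeff_X_pow, coeff_C_mul] at h0 h1
  have : ω = -1 := by linear_combination h0
  subst this
  apply hk
  have : (k : ℂ) = 2 := by rw [inv_neg, inv_one] at h1; linear_combination h1
  exact_mod_cast this

/-- Modulo `y - ω x` one may substitute `x = ω⁻¹ y` in `y ^ 2 f`. -/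
theorem eliminatesTo_sub_x (hx : x * x' = 1) (hy : y * y' = 1) {ω : ℂ} (hω : ω ≠ 0) :
    EliminatesTo y (hexPoly k x x' y y') (y - algebraMap ℂ A ω * x) := by
  have hw := algebraMap_mul_inv (A := A) hω
  refine ⟨_, quartic_ne_zero (β := ω) (κ := k) (inv_ne_zero hω), y ^ 2,
    (y ^ 3 + y ^ 2) * algebraMap ℂ A ω⁻¹ - (y ^ 2 + y) * x' * y', ?_⟩
  simp only [map_add, map_mul, map_pow, aeval_X, aeval_C, map_one, map_intCast, hexPoly]
  generalize algebraMap ℂ A ω = w at *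
  generalize algebraMap ℂ A ω⁻¹ = w' at *
  grind

/-- Modulo `y - ω x⁻¹` one may substitute `x = ω y⁻¹` in `y f`. -/
theorem eliminatesTo_sub_x' (hx : x * x' = 1) (hy : y * y' = 1) (hk : k ≠ 2) {ω : ℂ} (hω : ω ≠ 0) :
    EliminatesTo y (hexPoly k x x' y y') (y - algebraMap ℂ A ω * x') := by
  have hw := algebraMap_mul_inv (A := A) hω
  refine ⟨_, quadratic_ne_zero (ω := ω) hk, y,
    -((y + y ^ 2) * y' * x - (y + 1) * algebraMap ℂ A ω⁻¹), ?_⟩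
  simp only [map_add, map_mul, map_pow, aeval_X, aeval_C, map_one, map_intCast, hexPoly]
  generalize algebraMap ℂ A ω = w at *
  generalize algebraMap ℂ A ω⁻¹ = w' at *
  grind

/-- Modulo `y - ω x y` one may substitute `x = ω⁻¹` in `y f`. -/
theorem eliminatesTo_sub_xy (hx : x * x' = 1) (hy : y * y' = 1) (hk : k ≠ 2) {ω : ℂ} (hω : ω ≠ 0) :
    EliminatesTo y (hexPoly k x x' y y') (y - algebraMap ℂ A ω * (x * y)) := by
  have hw := algebraMap_mul_inv (A := A) hω
  refine ⟨_, quadratic_ne_zero (ω := ω⁻¹⁻¹) hk, y,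
    (y + y ^ 2) * algebraMap ℂ A ω⁻¹ * y' - (y + 1) * x' * y', ?_⟩
  rw [inv_inv]
  simp only [map_add, map_mul, map_pow, aeval_X, aeval_C, map_one, map_intCast, hexPoly]
  generalize algebraMap ℂ A ω = w at *
  generalize algebraMap ℂ A ω⁻¹ = w' at *
  grind

/-- Modulo `y - ω x⁻¹ y⁻¹` one may substitute `x = ω y⁻²` in `y ^ 2 f`. -/
theorem eliminatesTo_sub_x'y' (hx : x * x' = 1) (hy : y * y' = 1) {ω : ℂ} (hω : ω ≠ 0) :
    EliminatesTo y (hexPoly k x x' y y') (y - algebraMap ℂ A ω * (x' * y')) := by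
  have hw := algebraMap_mul_inv (A := A) hω
  refine ⟨_, quartic_ne_zero (β := ω) (κ := k) (inv_ne_zero hω), y ^ 2,
    -((y ^ 2 + y ^ 3) * x * y' - (y ^ 2 + y) * algebraMap ℂ A ω⁻¹ * y), ?_⟩
  simp only [map_add, map_mul, map_pow, aeval_X, aeval_C, map_one, map_intCast, hexPoly]
  generalize algebraMap ℂ A ω = w at *
  generalize algebraMap ℂ A ω⁻¹ = w' at *
  grind

end Elimination

/-! ### Linear recurrences over a finite alphabet -/

/-- A two-sided sequence over a finite alphabet satisfying the linear recurrence given by a nonzero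
polynomial is periodic, with a period that depends only on the recurrence and the alphabet. -/
theorem exists_uniform_period_of_recurrence {K α : Type*} [Field K] [Fintype α] (φ : α → K)
    (hφ : Function.Injective φ) {P : K[X]} (hP : P ≠ 0) :
    ∃ N : ℕ, 0 < N ∧ ∀ s : ℤ → α,
      (∀ n, ∑ i ∈ range (P.natDegree + 1), P.coeff i * φ (s (n + i)) = 0) →
      ∀ n, s (n + N) = s n := by
  classical
  set d := P.natDegree with hd
  set M := Fintype.card (Fin d → α) with hM
  -- a period found for one sequence is at most `M`, so `M!` serves for all of them
  refine ⟨M.factorial, M.factorial_pos, fun s hs n => ?_⟩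
  -- the recurrence determines the next symbol from a window of `d` symbols
  have step : ∀ i j : ℤ, (∀ t : ℕ, t < d → s (i + t) = s (j + t)) →
      ∀ t : ℕ, s (i + t) = s (j + t) := by
    intro i j hw t
    induction t using Nat.strong_induction_on with
    | _ t ih =>
      by_cases htd : t < d
      · exact hw t htd
      · obtain ⟨r, rfl⟩ := Nat.exists_eq_add_of_le (not_lt.mp htd)
        have h1 := hs (i + r)
        have h2 := hs (j + r)
        rw [Finset.sum_range_succ] at h1 h2
        have h3 : ∑ l ∈ range d, P.coeff l * φ (s (i + r + l)) =
            ∑ l ∈ range d, P.coeff l * φ (s (j + r + l)) := by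
          refine Finset.sum_congr rfl fun l hl => ?_
          have := ih (r + l) (by have := Finset.mem_range.mp hl; omega)
          push_cast at this
          rw [add_assoc, add_assoc, this]
        rw [h3, ← h2] at h1
        have h4 := mul_left_cancel₀ (Polynomial.leadingCoeff_ne_zero.mpr hP) (add_left_cancel h1)
        have h5 := hφ h4
        push_cast
        rw [add_comm (d : ℤ) r, ← add_assoc, ← add_assoc]
        exact h5
  -- among the `M + 1` windows starting at `n - M, …, n` two coincide
  obtain ⟨x, y, hxy, hw⟩ := Fintype.exists_ne_map_eq_of_card_lt
    (fun (x : Fin (M + 1)) (t : Fin d) => s (n - M + (x : ℕ) + (t : ℕ))) (by simp [← hM])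
  wlog hlt : x < y generalizing x y
  · exact this y x hxy.symm hw.symm (lt_of_le_of_ne (not_lt.mp hlt) hxy.symm)
  have hlt' : (x : ℕ) < y := hlt
  have hyM : (y : ℕ) ≤ M := Nat.lt_succ_iff.mp y.2
  obtain ⟨q, hq⟩ := Nat.exists_eq_add_of_lt hlt'
  have hper : ∀ t : ℕ, s (n - M + (x : ℕ) + t) = s (n - M + (y : ℕ) + t) :=
    step _ _ fun t ht => congrFun hw ⟨t, ht⟩
  have hmul : ∀ l : ℕ, ∀ t : ℕ,
      s (n - M + (x : ℕ) + t + l * ((q : ℤ) + 1)) = s (n - M + (x : ℕ) + t) := by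
    intro l
    induction l with
    | zero => intro t; simp
    | succ l ih =>
      intro t
      have h1 := ih (t + (q + 1))
      have h2 := hper t
      rw [hq] at h2
      push_cast at h1 h2 ⊢
      rw [h2, show n - M + (x : ℕ) + t + ((l : ℤ) + 1) * (q + 1) =
        n - M + (x : ℕ) + (t + (q + 1)) + l * (q + 1) by ring, h1]
      congr 1
      ring
  obtain ⟨l, hl⟩ : q + 1 ∣ M.factorial := Nat.dvd_factorial (Nat.succ_pos q) (by omega)
  have := hmul l (M - x)
  rw [Nat.cast_sub (by omega)] at this
  rw [hl]
  push_cast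
  rw [show n - M + (x : ℕ) + ((M : ℤ) - (x : ℕ)) = n by ring] at this
  rw [← this]
  congr 1
  ring

/-! ### Periodicity along a coordinate axis -/

/-- The closed neighborhood of the origin in the triangular grid. -/
def hexagon : Finset (ℤ × ℤ) :=
  {(0, 0), (1, 0), (-1, 0), (0, 1), (0, -1), (1, 1), (-1, -1)}

/-- The weights `k` at the origin and `1` elsewhere. -/
def hexWeight (k : ℤ) (d : ℤ × ℤ) : ℤ := if d = 0 then k else 1

theorem sum_hexWeight (k : ℤ) (F : ℤ × ℤ → ℤ) :
    ∑ d ∈ hexagon, hexWeight k d * F d = ∑ d ∈ hexagon, F d + (k - 1) * F 0 := by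
  rw [Prod.zero_eq_mk]
  simp [hexagon, hexWeight]
  ring

/-- A polynomial in the monomial `(0, 1)` acts by a linear recurrence along the second axis. -/
theorem shiftAction_aeval_single (P : ℂ[X]) (g : ℤ × ℤ → ℂ) (u : ℤ × ℤ) :
    shiftAction ℂ (ℤ × ℤ) (aeval (AddMonoidAlgebra.single (0, 1) 1) P) g u =
      ∑ i ∈ range (P.natDegree + 1), P.coeff i * g (u + (0, (i : ℤ))) := by
  rw [aeval_eq_sum_range, map_sum, LinearMap.sum_apply, Finset.sum_apply]
  refine Finset.sum_congr rfl fun i _ => ?_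
  rw [AddMonoidAlgebra.single_pow, one_pow, map_smul, LinearMap.smul_apply, Pi.smul_apply,
    shiftAction_single]
  simp

/-- A `{-1, 0, 1}`-valued function annihilated by the hexagonal stencil with `k ≠ 2` satisfies a
nontrivial linear recurrence along the second axis. -/
theorem exists_recurrence_of_hexagon {k : ℤ} (hk : k ≠ 2) {g : ℤ × ℤ → ℤ} (hg : ∀ u, |g u| ≤ 1)
    (h : ∀ u, ∑ d ∈ hexagon, hexWeight k d * g (u + d) = 0) :
    ∃ P : ℂ[X], P ≠ 0 ∧
      aeval (AddMonoidAlgebra.single (0, 1) 1) P ∈ annihilatorIdeal fun u => (g u : ℂ) := by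
  set I := annihilatorIdeal fun u => (g u : ℂ) with hI
  set B := (∑ d ∈ hexagon, |hexWeight k d|).toNat with hB
  set R := B.factorial with hR
  have hdil : ∀ m : ℕ, ∑ d ∈ hexagon,
      AddMonoidAlgebra.single ((1 + m * R) • d) (hexWeight k d : ℂ) ∈ I := by
    intro m
    rw [hI, mem_annihilatorIdeal]
    ext u
    rw [shiftAction_sum_single]
    have := stencil_dilation hg h (1 + m * R) (by omega) (fun p hp hpd => ?_) u
    · simpa using congrArg (Int.cast : ℤ → ℂ) this
    · by_contra hlt
      -- a prime up to `B` divides `R`, hence not `1 + m * R`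
      have hpB : p ≤ B := by omega
      have hpR : p ∣ m * R := ((hp.dvd_factorial).mpr hpB).mul_left m
      exact hp.one_lt.ne' (Nat.dvd_one.mp ((Nat.dvd_add_left hpR).mp hpd))
  have hmono : ∀ d e : ℤ × ℤ, (AddMonoidAlgebra.single d 1 * AddMonoidAlgebra.single e 1 :
      AddMonoidAlgebra ℂ (ℤ × ℤ)) = AddMonoidAlgebra.single (d + e) 1 := fun d e => by
    rw [AddMonoidAlgebra.single_mul_single, one_mul]
  have hone : (AddMonoidAlgebra.single (0, 0) 1 : AddMonoidAlgebra ℂ (ℤ × ℤ)) = 1 := rfl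
  set x : AddMonoidAlgebra ℂ (ℤ × ℤ) := AddMonoidAlgebra.single (1, 0) 1 with hx
  set x' : AddMonoidAlgebra ℂ (ℤ × ℤ) := AddMonoidAlgebra.single (-1, 0) 1 with hx'
  set y : AddMonoidAlgebra ℂ (ℤ × ℤ) := AddMonoidAlgebra.single (0, 1) 1 with hy
  set y' : AddMonoidAlgebra ℂ (ℤ × ℤ) := AddMonoidAlgebra.single (0, -1) 1 with hy'
  have hxx : x * x' = 1 := by rw [hx, hx', hmono]; rfl
  have hyy : y * y' = 1 := by rw [hy, hy', hmono]; rfl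
  have hxy : AddMonoidAlgebra.single (1, 1) 1 = x * y := by rw [hx, hy, hmono]; rfl
  have hxy' : AddMonoidAlgebra.single (-1, -1) 1 = x' * y' := by rw [hx', hy', hmono]; rfl
  have hf : hexPoly k x x' y y' ∈ I := by
    convert hdil 0 using 1
    have hk0 : (AddMonoidAlgebra.single ((0 : ℤ), (0 : ℤ)) (k : ℂ)) =
        (k : AddMonoidAlgebra ℂ (ℤ × ℤ)) := (map_intCast (algebraMap ℂ _) k)
    simp [hexagon, hexWeight, hk0, hexPoly, hxy, hxy', ← hx, ← hx', ← hy, ← hy']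
    ring
  -- isolating the monomial `y` leaves a product of differences of `R`-th powers of monomials
  have hprod : ∏ j ∈ hexagon.erase (0, 1), (y ^ R - AddMonoidAlgebra.single j 1 ^ R) ∈ I := by
    have := mul_prod_sub_mem_of_powerSum_mem (I := I) (D := hexagon)
      (w := fun d => AddMonoidAlgebra.single d (hexWeight k d : ℂ))
      (z := fun d => AddMonoidAlgebra.single d 1 ^ R) (fun m => ?_) (i := (0, 1))
      (by simp [hexagon])
    · have h2 := I.mul_mem_left y' this
      have h3 : AddMonoidAlgebra.single ((0 : ℤ), (1 : ℤ)) (hexWeight k (0, 1) : ℂ) = y := by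
        simp [hexWeight, hy]
      rwa [h3, ← mul_assoc, mul_comm y' y, hyy, one_mul] at h2
    · convert hdil m using 1
      refine Finset.sum_congr rfl fun d _ => ?_
      rw [AddMonoidAlgebra.single_pow, AddMonoidAlgebra.single_pow,
        AddMonoidAlgebra.single_mul_single, add_smul, one_smul, smul_smul]
      simp
  have hRpos : 0 < R := B.factorial_pos
  have helim : EliminatesTo y (hexPoly k x x' y y')
      (∏ j ∈ hexagon.erase (0, 1), (y ^ R - AddMonoidAlgebra.single j 1 ^ R)) := by
    refine EliminatesTo.prod fun j hj => ?_
    have hj' : j = (0, 0) ∨ j = (1, 0) ∨ j = (-1, 0) ∨ j = (0, -1) ∨ j = (1, 1) ∨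
        j = (-1, -1) := by
      simp only [hexagon, mem_erase, mem_insert, mem_singleton] at hj
      tauto
    rcases hj' with rfl | rfl | rfl | rfl | rfl | rfl
    · rw [hone]
      exact EliminatesTo.pow_sub_pow (one_mul 1) hRpos fun ω _ => eliminatesTo_sub_const ω _
    · exact EliminatesTo.pow_sub_pow hxx hRpos fun ω => eliminatesTo_sub_x hxx hyy
    · exact EliminatesTo.pow_sub_pow ((mul_comm _ _).trans hxx) hRpos
        fun ω => eliminatesTo_sub_x' hxx hyy hk
    · exact EliminatesTo.pow_sub_pow ((mul_comm _ _).trans hyy) hRpos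
        fun ω _ => eliminatesTo_sub_y' hyy ω _
    · rw [hxy]
      exact EliminatesTo.pow_sub_pow (z' := x' * y') (by linear_combination y * y' * hxx + hyy)
        hRpos fun ω => eliminatesTo_sub_xy hxx hyy hk
    · rw [hxy']
      exact EliminatesTo.pow_sub_pow (z' := x * y) (by linear_combination y * y' * hxx + hyy)
        hRpos fun ω => eliminatesTo_sub_x'y' hxx hyy
  obtain ⟨P, hP, a, b, hab⟩ := helim
  exact ⟨P, hP, hab ▸ I.add_mem (I.mul_mem_left a hf) (I.mul_mem_left b hprod)⟩

/-- A configuration with constant hexagonal sums, `k ≠ 2`, is periodic along the second axis. -/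
theorem exists_period_snd {k a : ℤ} (hk : k ≠ 2) {c : ℤ × ℤ → Fin 2}
    (h : ∀ u, ∑ d ∈ hexagon, hexWeight k d * ((c (u + d) : ℕ) : ℤ) = a) :
    ∃ N : ℕ, 0 < N ∧ ∀ u, c (u + (0, (N : ℤ))) = c u := by
  -- differencing in the second coordinate removes the constant `a`
  obtain ⟨P, hP, hmem⟩ := exists_recurrence_of_hexagon hk
    (g := fun u => ((c (u + (0, 1)) : ℕ) : ℤ) - ((c u : ℕ) : ℤ))
    (fun u => by rw [abs_le]; omega)
    (fun u => by
      have := (congrArg₂ (· - ·) (h (u + (0, 1))) (h u))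
      simp only [← Finset.sum_sub_distrib, ← mul_sub, sub_self] at this
      simpa [add_right_comm] using this)
  obtain ⟨N, hN, hper⟩ := exists_uniform_period_of_recurrence (fun i : Fin 2 => ((i : ℕ) : ℂ))
    (fun i j hij => Fin.ext (Nat.cast_injective hij)) (mul_ne_zero hP (X_sub_C_ne_zero 1))
  refine ⟨N, hN, fun u => ?_⟩
  have := hper (fun n => c (u.1, n)) (fun n => ?_) u.2
  · simpa [Prod.add_def] using this
  · have hact := shiftAction_aeval_single (P * (X - C 1)) (fun u => ((c u : ℕ) : ℂ)) (u.1, n)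
    simp only [Prod.mk_add_mk, add_zero] at hact
    rw [← hact, map_mul, map_mul, Module.End.mul_apply]
    have hdiff : shiftAction ℂ (ℤ × ℤ) (aeval (AddMonoidAlgebra.single (0, 1) 1) (X - C (1 : ℂ)))
        (fun u => ((c u : ℕ) : ℂ)) =
        fun u => (((((c (u + (0, 1)) : ℕ) : ℤ) - ((c u : ℕ) : ℤ) : ℤ)) : ℂ) := by
      ext v
      simp [shiftAction_single]
    rw [hdiff, mem_annihilatorIdeal.mp hmem]
    rfl

/-- Periodicity along the first axis, as the stencil is invariant under exchanging the coordinates. -/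
theorem exists_period_fst {k a : ℤ} (hk : k ≠ 2) {c : ℤ × ℤ → Fin 2}
    (h : ∀ u, ∑ d ∈ hexagon, hexWeight k d * ((c (u + d) : ℕ) : ℤ) = a) :
    ∃ N : ℕ, 0 < N ∧ ∀ u, c (u + ((N : ℤ), 0)) = c u := by
  obtain ⟨N, hN, hper⟩ := exists_period_snd (a := a) (c := fun u => c u.swap) hk fun u => by
    rw [← h u.swap]
    refine Finset.sum_nbij' Prod.swap Prod.swap ?_ ?_ ?_ ?_ ?_ <;>
      simp [hexagon, hexWeight, Prod.ext_iff, and_comm] <;> tauto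
  exact ⟨N, hN, fun u => by simpa using hper u.swap⟩

/-! ### Coverings of the triangular grid -/

theorem mem_closedNeighborhood_triangularGrid {u v : ℤ × ℤ} :
    v ∈ closedNeighborhood triangularGrid 1 u ↔ ∃ d ∈ hexagon, u + d = v := by
  have : v ∈ closedNeighborhood triangularGrid 1 u ↔ v - u ∈ hexagon := by
    change triangularGrid.edist v u ≤ ((1 : ℕ) : ℕ∞) ↔ _
    rw [Nat.cast_one, SimpleGraph.edist_le_one_iff_adj_or_eq]
    have h0 : v - u = (0, 0) ↔ v = u := sub_eq_zero
    simp [triangularGrid, hexagon, h0]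
    tauto
  rw [this]
  exact ⟨fun h => ⟨_, h, add_sub_cancel u v⟩, by rintro ⟨d, hd, rfl⟩; simpa using hd⟩

theorem closedNeighborhood_eq_image (u : ℤ × ℤ) :
    closedNeighborhood triangularGrid 1 u =
      (fun d => u + d) '' closedNeighborhood triangularGrid 1 (0, 0) := by
  ext v
  simp only [mem_closedNeighborhood_triangularGrid, Set.mem_image]
  constructor
  · rintro ⟨d, hd, rfl⟩
    exact ⟨d, ⟨d, hd, zero_add d⟩, rfl⟩
  · rintro ⟨_, ⟨d, hd, rfl⟩, rfl⟩
    exact ⟨d, hd, congrArg (u + ·) (zero_add d).symm⟩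

/-- The number of symbols `1` around `u`, as a sum over the hexagon. -/
theorem encard_ones_eq_sum (c : ℤ × ℤ → Fin 2) (u : ℤ × ℤ) :
    {v ∈ (fun d => u + d) '' closedNeighborhood triangularGrid 1 (0, 0) | c v = 1}.encard =
      ((∑ d ∈ hexagon, (c (u + d) : ℕ) : ℕ) : ℕ∞) := by
  have : {v ∈ (fun d => u + d) '' closedNeighborhood triangularGrid 1 (0, 0) | c v = 1} =
      (fun d => u + d) '' ((hexagon.filter fun d => c (u + d) = 1 : Finset _) : Set (ℤ × ℤ)) := by
    rw [← closedNeighborhood_eq_image]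
    ext v
    simp only [Set.mem_ofPred_eq, mem_closedNeighborhood_triangularGrid, Set.mem_image, coe_filter]
    constructor
    · rintro ⟨⟨d, hd, rfl⟩, hc⟩
      exact ⟨d, ⟨hd, hc⟩, rfl⟩
    · rintro ⟨d, ⟨hd, hc⟩, rfl⟩
      exact ⟨⟨d, hd, rfl⟩, hc⟩
  rw [this, (add_right_injective u).encard_image, Set.encard_coe_eq_coe_finsetCard,
    Finset.card_filter]
  congr 2
  ext d
  rcases Fin.exists_fin_two.mp ⟨c (u + d), rfl⟩ with h | h <;> simp [h]

theorem IsConfigCovering.exists_periods {b a : ℕ} (hba : (b : ℤ) - (a : ℤ) ≠ -1)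
    {c : ℤ × ℤ → Fin 2}
    (hc : IsConfigCovering (closedNeighborhood triangularGrid 1 (0, 0)) b a c) :
    ∃ M N : ℕ, 0 < M ∧ 0 < N ∧ (∀ u, c (u + ((M : ℤ), 0)) = c u) ∧
      ∀ u, c (u + (0, (N : ℤ))) = c u := by
  have hsum : ∀ u, ∑ d ∈ hexagon, hexWeight (1 - (b - a)) d * ((c (u + d) : ℕ) : ℤ) = a := by
    intro u
    rw [sum_hexWeight, add_zero]
    obtain ⟨h1, h0⟩ := hc u
    rw [encard_ones_eq_sum] at h1 h0
    rcases Fin.exists_fin_two.mp ⟨c u, rfl⟩ with h | h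
    · have := h0 h
      rw [h]
      have h' : ∑ d ∈ hexagon, (c (u + d) : ℕ) = a := by exact_mod_cast this
      rw [← h']
      simp
    · have := h1 h
      rw [h]
      have h' : ∑ d ∈ hexagon, (c (u + d) : ℕ) = b := by exact_mod_cast this
      rw [← h']
      simp
  have hk : 1 - ((b : ℤ) - a) ≠ 2 := by omega
  obtain ⟨M, hM, hM'⟩ := exists_period_fst hk hsum
  obtain ⟨N, hN, hN'⟩ := exists_period_snd hk hsum
  exact ⟨M, N, hM, hN, hM', hN'⟩

theorem linearIndependent_axes {M N : ℕ} (hM : 0 < M) (hN : 0 < N) :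
    LinearIndependent ℤ ![((M : ℤ), (0 : ℤ)), ((0 : ℤ), (N : ℤ))] := by
  rw [LinearIndependent.pair_iff]
  intro s t h
  simp [hM.ne', hN.ne'] at h
  exact h

theorem translate_eq_of_period {A : Type*} {c : ℤ × ℤ → A} {t : ℤ × ℤ}
    (h : ∀ u, c (u + t) = c u) : translate t c = c := by
  ext u
  rw [translate, ← h (u - t), sub_add_cancel]

theorem IsConfigCovering.isTwoPeriodicConfig {b a : ℕ} (hba : (b : ℤ) - (a : ℤ) ≠ -1)
    {c : ℤ × ℤ → Fin 2}
    (hc : IsConfigCovering (closedNeighborhood triangularGrid 1 (0, 0)) b a c) :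
    IsTwoPeriodicConfig c := by
  obtain ⟨M, N, hM, hN, hM', hN'⟩ := hc.exists_periods hba
  exact ⟨_, _, linearIndependent_axes hM hN, translate_eq_of_period hM',
    translate_eq_of_period hN'⟩

open Classical in
/-- The indicator configuration of a code. -/
noncomputable def codeConfig (S : Set (ℤ × ℤ)) (u : ℤ × ℤ) : Fin 2 := if u ∈ S then 1 else 0

theorem codeConfig_eq_one {S : Set (ℤ × ℤ)} {u : ℤ × ℤ} : codeConfig S u = 1 ↔ u ∈ S := by
  simp [codeConfig]

theorem codeConfig_eq_zero {S : Set (ℤ × ℤ)} {u : ℤ × ℤ} : codeConfig S u = 0 ↔ u ∉ S := by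
  simp [codeConfig]

theorem IsCodeCovering.isConfigCovering {b a : ℕ} {S : Set (ℤ × ℤ)}
    (hS : IsCodeCovering triangularGrid 1 b a S) :
    IsConfigCovering (closedNeighborhood triangularGrid 1 (0, 0)) b a (codeConfig S) := by
  intro u
  simp only [← closedNeighborhood_eq_image, codeConfig_eq_one, codeConfig_eq_zero]
  exact hS u

theorem eq_image_of_translate_codeConfig {S : Set (ℤ × ℤ)} {t : ℤ × ℤ}
    (h : translate t (codeConfig S) = codeConfig S) : S = (fun s => s + t) '' S := by
  ext u
  rw [Set.image_add_right, Set.mem_preimage, ← sub_eq_add_neg, ← codeConfig_eq_one,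
    ← codeConfig_eq_one, ← congrFun h u, translate]

end PerfectCovering

theorem mainTheorem6 (b a : ℕ) (hba : (b : ℤ) - (a : ℤ) ≠ -1) :
    (∀ c : ℤ × ℤ → Fin 2,
      PerfectCovering.IsConfigCovering
        (PerfectCovering.closedNeighborhood PerfectCovering.triangularGrid 1 (0, 0)) b a c →
      PerfectCovering.IsTwoPeriodicConfig c) ∧
    (∀ S : Set (ℤ × ℤ),
      PerfectCovering.IsCodeCovering PerfectCovering.triangularGrid 1 b a S →
      PerfectCovering.IsTwoPeriodicCode S) := by
  refine ⟨fun c hc => hc.isTwoPeriodicConfig hba, fun S hS => ?_⟩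
  obtain ⟨t₁, t₂, hind, h₁, h₂⟩ := hS.isConfigCovering.isTwoPeriodicConfig hba
  exact ⟨t₁, t₂, hind, PerfectCovering.eq_image_of_translate_codeConfig h₁,
    PerfectCovering.eq_image_of_translate_codeConfig h₂⟩
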